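/- Let $\mathcal X$ be a complex Hilbert space, let $B$ be a (densely defined, possibly unbounded) selfadjoint operator in $\mathcal X$ with domain $D(B)$, and let $J$ be a bounded linear operator on $\mathcal X$ with $J^*=-J$ and $J^2=-1$. Put $A=JB$ with $D(A)=D(B)$. Assume Condition $\mathrm P_+$: $\sigma(B)\subset[\delta,\infty)$ for some $\delta>0$. Let $\Lambda=B^{1/2}$ be the nonnegative selfadjoint square root of $B$, and let $\mathcal V=D(\Lambda)$ with the norm $\|X\|_{\mathcal V}=\|\Lambda X\|_{\mathcal X}$. Then $\mathcal V$ is a Hilbert space and $\Lambda:\mathcal V\to\mathcal X$ is unitary, with inverse $\Lambda^{-1}:\mathcal X\to\mathcal V$. Let $H=\Lambda\, iJ\,\Lambda$ with domain $D(H)=\{X\in\mathcal V: J\Lambda X\in\mathcal V\}$. Then the following hold. 1. $H$ is selfadjoint, so that $e^{-iHt}$, $t\in\mathbb R$, the strongly continuous one-parameter unitary group on $\mathcal X$ with generator $-iH$, exists. 2. For every $Z_0\in\mathcal X$, the function $Z(t)=e^{-iHt}Z_0$ is the unique $Z\in C(\mathbb R,\mathcal X)$ with $Z(0)=Z_0$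 and $$iH^{-1}[Z(t)-Z(0)]=\int_0^t Z(s)\,ds\quad\text{for all }t\in\mathbb R .$$ 3. For every $X_0\in\mathcal V$, the function $X(t)=\Lambda^{-1}e^{-iHt}\Lambda X_0$ is the unique $X\in C(\mathbb R,\mathcal V)$ with $X(0)=X_0$ and $$A^{-1}[X(t)-X(0)]=\int_0^t X(s)\,ds\quad\text{for all }t\in\mathbb R ,$$ where the integral converges in $\mathcal V$. 4. The maps $V(t):X_0\mapsto X(t)$, $t\in\mathbb R$, are unitary operators on $\mathcal V$ satisfying $V(0)=1$ and $V(s+t)=V(s)V(t)$ for all $s,t\in\mathbb R$; in particular $\|X(t)\|_{\mathcal V}=\|X_0\|_{\mathcal V}$. -/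

import Mathlib

open scoped InnerProductSpace

noncomputable section

namespace KreinGroup

variable {𝒳 : Type*} [NormedAddCommGroup 𝒳] [InnerProductSpace ℂ 𝒳]

/-- `R` is the (bounded, everywhere defined) resolvent `(T - z)⁻¹` of the unbounded operator `T`. -/
def IsResolventAt (T : 𝒳 →ₗ.[ℂ] 𝒳) (z : ℂ) (R : 𝒳 →L[ℂ] 𝒳) : Prop :=
  (∀ y : 𝒳, ∃ h : R y ∈ T.domain, T ⟨R y, h⟩ - z • R y = y) ∧
    ∀ x : T.domain, R (T x - z • (x : 𝒳)) = x

/-- The spectrum of an unbounded operator: those `z` for which `T - z : D(T) → 𝒳`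
has no bounded inverse defined on all of `𝒳`. -/
def unboundedSpectrum (T : 𝒳 →ₗ.[ℂ] 𝒳) : Set ℂ :=
  {z | ¬ ∃ R : 𝒳 →L[ℂ] 𝒳, IsResolventAt T z R}

/-- Condition `P₊`: `σ(B) ⊆ [δ, ∞)` for some `δ > 0`. -/
def ConditionP (B : 𝒳 →ₗ.[ℂ] 𝒳) : Prop :=
  ∃ δ : ℝ, 0 < δ ∧ unboundedSpectrum B ⊆ ((↑) : ℝ → ℂ) '' Set.Ici δ

/-- The product `g f` of unbounded operators, on its natural domain
`{x ∈ D(f) : f x ∈ D(g)}`. -/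
def pcomp (g f : 𝒳 →ₗ.[ℂ] 𝒳) : 𝒳 →ₗ.[ℂ] 𝒳 where
  domain :=
    { carrier := {x | ∃ h : x ∈ f.domain, f ⟨x, h⟩ ∈ g.domain}
      zero_mem' := ⟨f.domain.zero_mem, by
        have : f ⟨0, f.domain.zero_mem⟩ = 0 := f.map_zero
        rw [this]
        exact g.domain.zero_mem⟩
      add_mem' := by
        rintro x y ⟨hx, hx'⟩ ⟨hy, hy'⟩
        refine ⟨f.domain.add_mem hx hy, ?_⟩
        have := f.map_add ⟨x, hx⟩ ⟨y, hy⟩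
        exact this ▸ g.domain.add_mem hx' hy'
      smul_mem' := by
        rintro c x ⟨hx, hx'⟩
        refine ⟨f.domain.smul_mem c hx, ?_⟩
        have := f.map_smul c ⟨x, hx⟩
        exact this ▸ g.domain.smul_mem c hx' }
  toFun :=
    { toFun := fun x => g ⟨f ⟨x, x.2.1⟩, x.2.2⟩
      map_add' := by
        intro x y
        rw [← g.map_add]
        congr 1
        exact Subtype.ext (f.map_add ⟨x, x.2.1⟩ ⟨y, y.2.1⟩)
      map_smul' := by
        intro c x
        rw [RingHom.id_apply, ← g.map_smul]
        congr 1
        exact Subtype.ext (f.map_smul c ⟨x, x.2.1⟩) }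

theorem mem_pcomp_graph {g f : 𝒳 →ₗ.[ℂ] 𝒳} {x y : 𝒳} :
    (x, y) ∈ (pcomp g f).graph ↔ ∃ z, (x, z) ∈ f.graph ∧ (z, y) ∈ g.graph := by
  simp only [LinearPMap.mem_graph_iff]
  constructor
  · rintro ⟨u, rfl, rfl⟩
    exact ⟨f ⟨u, u.2.1⟩, ⟨⟨u, u.2.1⟩, rfl, rfl⟩, ⟨⟨_, u.2.2⟩, rfl, rfl⟩⟩
  · rintro ⟨z, ⟨u, rfl, rfl⟩, ⟨v, hv, rfl⟩⟩
    have hm : f u ∈ g.domain := hv ▸ v.2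
    refine ⟨⟨u, u.2, hm⟩, rfl, ?_⟩
    change g ⟨f u, hm⟩ = g v
    congr 1
    exact Subtype.ext hv.symm

theorem exists_resolvent_zero {B : 𝒳 →ₗ.[ℂ] 𝒳} (hP : ConditionP B) :
    ∃ R : 𝒳 →L[ℂ] 𝒳, IsResolventAt B 0 R := by
  obtain ⟨δ, hδ, h⟩ := hP
  by_contra h0
  obtain ⟨r, hr, h1⟩ := h (show (0 : ℂ) ∈ unboundedSpectrum B from h0)
  have : r = 0 := by exact_mod_cast h1
  have : δ ≤ r := hr
  linarith

section Sqrt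

variable [CompleteSpace 𝒳]

/-- `Λ` is the square root `B^{1/2}`: a nonnegative selfadjoint operator with `Λ² = B`
(equality of unbounded operators, domains included). -/
structure IsNonnegSqrt (B Λ : 𝒳 →ₗ.[ℂ] 𝒳) : Prop where
  isSelfAdjoint : IsSelfAdjoint Λ
  nonneg : ∀ x : Λ.domain, 0 ≤ (⟪Λ x, (x : 𝒳)⟫_ℂ).re
  sq : pcomp Λ Λ = B

theorem resolvent_nonneg {B : 𝒳 →ₗ.[ℂ] 𝒳} (hB : IsSelfAdjoint B) (hP : ConditionP B)
    {R : 𝒳 →L[ℂ] 𝒳} (hR : IsResolventAt B 0 R) : 0 ≤ R := by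
  have hfa : B.IsFormalAdjoint B := by
    have h := LinearPMap.adjoint_isFormalAdjoint hB.dense_domain
    rwa [LinearPMap.isSelfAdjoint_def.mp hB] at h
  have hsym : (R : 𝒳 →ₗ[ℂ] 𝒳).IsSymmetric := by
    intro x y
    obtain ⟨hx, hx'⟩ := hR.1 x
    obtain ⟨hy, hy'⟩ := hR.1 y
    simp only [zero_smul, sub_zero] at hx' hy'
    have := hfa ⟨R x, hx⟩ ⟨R y, hy⟩
    rw [hx', hy'] at this
    exact this.symm
  have hsa : IsSelfAdjoint R := ContinuousLinearMap.isSelfAdjoint_iff_isSymmetric.mpr hsym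
  obtain ⟨δ, hδ, hspec⟩ := hP
  rw [nonneg_iff_isSelfAdjoint_and_quasispectrumRestricts]
  refine ⟨hsa, QuasispectrumRestricts.nnreal_iff.mpr fun r hr => ?_⟩
  rw [quasispectrum_eq_spectrum_union_zero] at hr
  rcases hr with hr | hr
  swap
  · exact (Set.mem_singleton_iff.mp hr).ge
  by_contra! hneg
  apply hr
  have hr0 : (r : ℂ) ≠ 0 := by exact_mod_cast hneg.ne
  obtain ⟨S, hS⟩ : ∃ S, IsResolventAt B (r : ℂ)⁻¹ S := by
    by_contra hno
    obtain ⟨a, ha, ha'⟩ := hspec (show (r : ℂ)⁻¹ ∈ unboundedSpectrum B from hno)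
    have h1 : a = r⁻¹ := by exact_mod_cast ha'
    have h2 : δ ≤ a := ha
    have h3 := inv_lt_zero.mpr hneg
    linarith
  set w : ℂ := (r : ℂ)⁻¹
  have hwr : w * r = 1 := inv_mul_cancel₀ hr0
  have halg : ∀ x : 𝒳, (algebraMap ℝ (𝒳 →L[ℂ] 𝒳) r) x = (r : ℂ) • x := fun x => by
    rw [Algebra.algebraMap_eq_smul_one]
    simp
  have hRB : ∀ x : B.domain, R (B x) = x := fun x => by simpa using hR.2 x
  let T : 𝒳 →L[ℂ] 𝒳 := w • (1 + w • S)
  have e1 : (algebraMap ℝ (𝒳 →L[ℂ] 𝒳) r - R) * T = 1 := by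
    ext y
    obtain ⟨hs, hs'⟩ := hS.1 y
    have h1 : R y = S y - w • R (S y) := by
      conv_lhs => rw [← hs', map_sub, map_smul, hRB]
    simp only [T, mul_apply_eq_comp, sub_apply, halg,
      smul_apply, add_apply,
      one_apply_eq_self, map_smul, map_add, h1]
    linear_combination (norm := module) hwr • (y + w • S y)
  have e2 : T * (algebraMap ℝ (𝒳 →L[ℂ] 𝒳) r - R) = 1 := by
    ext x
    obtain ⟨hu, hu'⟩ := hR.1 x
    have h1 : S x = R x + w • S (R x) := by
      have := hS.2 ⟨R x, hu⟩
      simp only [zero_smul, sub_zero] at hu'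
      rw [hu', map_sub, map_smul, sub_eq_iff_eq_add] at this
      exact this
    simp only [T, mul_apply_eq_comp, sub_apply, halg,
      smul_apply, add_apply,
      one_apply_eq_self, map_smul, map_sub, h1]
    linear_combination (norm := module) hwr • (x + w • R x + (w * w) • S (R x))
  exact ⟨⟨_, T, e1, e2⟩, rfl⟩

theorem exists_isNonnegSqrt {B : 𝒳 →ₗ.[ℂ] 𝒳} (hB : IsSelfAdjoint B) (hP : ConditionP B) :
    ∃ Λ : 𝒳 →ₗ.[ℂ] 𝒳, IsNonnegSqrt B Λ := by
  obtain ⟨R, hR⟩ := exists_resolvent_zero hP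
  have hR0 := resolvent_nonneg hB hP hR
  have hRB : ∀ y, (R y, y) ∈ B.graph := fun y => by
    obtain ⟨h, h'⟩ := hR.1 y
    rw [LinearPMap.mem_graph_iff]
    exact ⟨⟨R y, h⟩, rfl, by simpa using h'⟩
  have hBR : ∀ {x y}, (x, y) ∈ B.graph → R y = x := fun {x y} h => by
    obtain ⟨u, rfl, rfl⟩ := (LinearPMap.mem_graph_iff _).mp h
    simpa using hR.2 u
  have hRinj : ∀ y, R y = 0 → y = 0 := fun y hy => by
    have h1 := hRB y
    rw [hy] at h1
    exact B.mem_graph_snd_inj h1 B.graph.zero_mem rfl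
  obtain ⟨Q, hQ0, hQQ⟩ : ∃ Q : 𝒳 →L[ℂ] 𝒳, 0 ≤ Q ∧ Q * Q = R :=
    ⟨CFC.sqrt R, CFC.sqrt_nonneg R, CFC.sqrt_mul_sqrt_self R⟩
  have hQQ' : ∀ x, Q (Q x) = R x := fun x => by rw [← hQQ]; rfl
  have hQpos := (ContinuousLinearMap.nonneg_iff_isPositive Q).mp hQ0
  have hQsym : ∀ x y, ⟪Q x, y⟫_ℂ = ⟪x, Q y⟫_ℂ := fun x y => hQpos.isSymmetric x y
  have hQinj : ∀ y, Q y = 0 → y = 0 := fun y hy => hRinj y (by rw [← hQQ', hy, map_zero])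
  set P : 𝒳 →ₗ.[ℂ] 𝒳 := (Q : 𝒳 →ₗ[ℂ] 𝒳).toPMap ⊤
  have hP : LinearMap.ker P.toFun = ⊥ := by
    rw [LinearMap.ker_eq_bot']
    exact fun m hm => Subtype.ext (hQinj m hm)
  set Λ := P.inverse
  have hg : ∀ {x y}, (x, y) ∈ Λ.graph ↔ Q y = x := by
    intro x y
    rw [LinearPMap.inverse_graph hP]
    simp only [Submodule.mem_map, LinearPMap.mem_graph_iff, Prod.exists]
    constructor
    · rintro ⟨a, b, ⟨u, rfl, rfl⟩, h⟩
      obtain ⟨h1, h2⟩ := Prod.ext_iff.mp h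
      exact (congrArg Q h2.symm).trans h1
    · rintro rfl
      exact ⟨y, Q y, ⟨⟨y, trivial⟩, rfl, rfl⟩, rfl⟩
  have happ : ∀ x : Λ.domain, Q (Λ x) = x := fun x => hg.mp (Λ.mem_graph x)
  have hmem : ∀ y, ∃ h : Q y ∈ Λ.domain, Λ ⟨Q y, h⟩ = y := fun y => by
    obtain ⟨u, hu, hu'⟩ := (LinearPMap.mem_graph_iff _).mp (hg.mpr (rfl : Q y = Q y))
    have h : Q y ∈ Λ.domain := by
      have := u.2
      rwa [hu] at this
    refine ⟨h, ?_⟩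
    have hu'' : Λ u = y := hu'
    have e : (⟨Q y, h⟩ : Λ.domain) = u := Subtype.ext hu.symm
    rw [e]
    exact hu''
  have hdense : Dense (Λ.domain : Set 𝒳) := by
    refine hB.dense_domain.mono fun x hx => ?_
    have h1 := hBR (B.mem_graph ⟨x, hx⟩)
    rw [← hQQ'] at h1
    obtain ⟨h, -⟩ := hmem (Q (B ⟨x, hx⟩))
    rw [h1] at h
    exact h
  refine ⟨Λ, ?_, ?_, ?_⟩
  · rw [LinearPMap.isSelfAdjoint_def]
    apply le_antisymm
    · have key : ∀ y : Λ.adjoint.domain, Q (Λ.adjoint y) = y := by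
        intro y
        refine ext_inner_right ℂ fun v => ?_
        obtain ⟨h, h'⟩ := hmem v
        have := LinearPMap.adjoint_isFormalAdjoint hdense y ⟨Q v, h⟩
        rw [h'] at this
        rw [hQsym]; exact this
      rw [← LinearPMap.le_graph_iff]
      rintro ⟨x, y⟩ hxy
      obtain ⟨u, rfl, rfl⟩ := (LinearPMap.mem_graph_iff _).mp hxy
      exact hg.mpr (key u)
    · refine LinearPMap.IsFormalAdjoint.le_adjoint hdense fun x y => ?_
      conv_lhs => rw [← happ y]
      conv_rhs => rw [← happ x]
      exact (hQsym _ _).symm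
  · intro x
    have h1 := hQpos.re_inner_nonneg_right (Λ x)
    rw [happ] at h1
    exact h1
  · apply LinearPMap.eq_of_eq_graph
    ext ⟨x, y⟩
    rw [mem_pcomp_graph]
    simp only [hg]
    constructor
    · rintro ⟨z, rfl, rfl⟩
      rw [hQQ']; exact hRB y
    · intro h
      exact ⟨Q y, by rw [hQQ', hBR h], rfl⟩

/-- `Λ = B^{1/2}`. -/
def opSqrt {B : 𝒳 →ₗ.[ℂ] 𝒳} (hB : IsSelfAdjoint B) (hP : ConditionP B) : 𝒳 →ₗ.[ℂ] 𝒳 :=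
  (exists_isNonnegSqrt hB hP).choose

theorem opSqrt_spec {B : 𝒳 →ₗ.[ℂ] 𝒳} (hB : IsSelfAdjoint B) (hP : ConditionP B) :
    IsNonnegSqrt B (opSqrt hB hP) :=
  (exists_isNonnegSqrt hB hP).choose_spec

variable {B : 𝒳 →ₗ.[ℂ] 𝒳} (hB : IsSelfAdjoint B) (hP : ConditionP B)

/-- The energy space `𝒱`: the domain of `Λ = B^{1/2}`, to be endowed with `‖x‖_𝒱 = ‖Λ x‖`. -/
def EnergySpace : Type _ := (opSqrt hB hP).domain

namespace EnergySpace

instance : AddCommGroup (EnergySpace hB hP) :=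
  inferInstanceAs (AddCommGroup (opSqrt hB hP).domain)

instance : Module ℂ (EnergySpace hB hP) :=
  inferInstanceAs (Module ℂ (opSqrt hB hP).domain)

/-- The inclusion `𝒱 ⊆ 𝒳`. -/
def incl : EnergySpace hB hP →ₗ[ℂ] 𝒳 := (opSqrt hB hP).domain.subtype

/-- `Λ` as a linear map `𝒱 → 𝒳`. -/
def lam : EnergySpace hB hP →ₗ[ℂ] 𝒳 := (opSqrt hB hP).toFun

theorem lam_injective : Function.Injective (lam hB hP) := by
  rw [injective_iff_map_eq_zero]
  intro x hx
  obtain ⟨R, hR⟩ := exists_resolvent_zero hP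
  have h1 : (incl hB hP x, (0 : 𝒳)) ∈ (pcomp (opSqrt hB hP) (opSqrt hB hP)).graph := by
    refine mem_pcomp_graph.mpr ⟨0, ?_, (opSqrt hB hP).graph.zero_mem⟩
    rw [← hx]
    exact (opSqrt hB hP).mem_graph x
  rw [(opSqrt_spec hB hP).sq] at h1
  obtain ⟨u, hu, hu'⟩ := (LinearPMap.mem_graph_iff _).mp h1
  have hu'' : B u = 0 := hu'
  have h2 := hR.2 u
  rw [hu'', zero_smul, sub_zero, map_zero] at h2
  exact Subtype.ext (hu.symm.trans h2.symm)

theorem lam_surjective : Function.Surjective (lam hB hP) := by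
  intro y
  obtain ⟨R, hR⟩ := exists_resolvent_zero hP
  obtain ⟨h, h'⟩ := hR.1 y
  have h1 : (R y, y) ∈ B.graph :=
    (LinearPMap.mem_graph_iff _).mpr ⟨⟨R y, h⟩, rfl, by simpa using h'⟩
  rw [← (opSqrt_spec hB hP).sq, mem_pcomp_graph] at h1
  obtain ⟨z, -, hz⟩ := h1
  obtain ⟨v, -, hv⟩ := (LinearPMap.mem_graph_iff _).mp hz
  exact ⟨v, hv⟩

/-- The energy norm `‖x‖_𝒱 = ‖Λ x‖_𝒳`. -/
instance : NormedAddCommGroup (EnergySpace hB hP) :=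
  NormedAddCommGroup.induced _ _ (lam hB hP) (lam_injective hB hP)

/-- The energy inner product `⟪x, y⟫_𝒱 = ⟪Λ x, Λ y⟫_𝒳`. -/
instance : InnerProductSpace ℂ (EnergySpace hB hP) where
  norm_smul_le c x := by
    change ‖lam hB hP (c • x)‖ ≤ ‖c‖ * ‖lam hB hP x‖
    rw [map_smul, norm_smul]
  inner x y := ⟪lam hB hP x, lam hB hP y⟫_ℂ
  norm_sq_eq_re_inner x := norm_sq_eq_re_inner (𝕜 := ℂ) (lam hB hP x)
  conj_inner_symm x y := inner_conj_symm _ _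
  add_left x y z := by rw [map_add, inner_add_left]
  smul_left x y c := by rw [map_smul, inner_smul_left]

/-- `Λ` as the unitary operator `𝒱 → 𝒳`; its inverse is `Λ⁻¹ : 𝒳 → 𝒱`. -/
def lamIso : EnergySpace hB hP ≃ₗᵢ[ℂ] 𝒳 where
  toLinearEquiv := LinearEquiv.ofBijective (lam hB hP)
    ⟨lam_injective hB hP, lam_surjective hB hP⟩
  norm_map' _ := rfl

instance : CompleteSpace (EnergySpace hB hP) :=
  (completeSpace_congr (e := (lamIso hB hP).toEquiv)
    (lamIso hB hP).isometry.isUniformEmbedding).mpr inferInstance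

end EnergySpace

/-- The Hamilton operator `A = J B`, with domain `D(B)`. -/
def hamiltonOp (B : 𝒳 →ₗ.[ℂ] 𝒳) (J : 𝒳 →L[ℂ] 𝒳) : 𝒳 →ₗ.[ℂ] 𝒳 :=
  (J : 𝒳 →ₗ[ℂ] 𝒳).compPMap B

/-- The Schrödinger operator `H = Λ iJ Λ`, with domain `{x ∈ 𝒱 : J Λ x ∈ 𝒱}`. -/
def schrodingerOp (J : 𝒳 →L[ℂ] 𝒳) : 𝒳 →ₗ.[ℂ] 𝒳 :=
  pcomp (opSqrt hB hP) (((Complex.I • J : 𝒳 →L[ℂ] 𝒳) : 𝒳 →ₗ[ℂ] 𝒳).compPMap (opSqrt hB hP))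

/-- `U t = e^{-iHt}`: a strongly continuous one-parameter unitary group whose generator
(domain included) is `-iH`. -/
structure IsUnitaryGroupOf (H : 𝒳 →ₗ.[ℂ] 𝒳) (U : ℝ → 𝒳 →L[ℂ] 𝒳) : Prop where
  unitary : ∀ t, U t ∈ unitary (𝒳 →L[ℂ] 𝒳)
  zero : U 0 = 1
  add : ∀ s t, U (s + t) = U s * U t
  continuous : ∀ z, Continuous fun t => U t z
  generator : ∀ z w, (z, w) ∈ H.graph ↔ HasDerivAt (fun t => U t z) (-(Complex.I • w)) 0

open scoped Classical in
/-- `e^{-iHt}`, the unitary group of `H` (and `1` for operators that have none). -/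
def expGroup (H : 𝒳 →ₗ.[ℂ] 𝒳) : ℝ → 𝒳 →L[ℂ] 𝒳 :=
  if h : ∃ U, IsUnitaryGroupOf H U then h.choose else fun _ => 1

/-- `X ∈ C(ℝ, 𝒱)` solves `Ẋ = A X` in the sense
`A⁻¹ [X(t) - X(0)] = ∫₀ᵗ X(s) ds` for all real `t`, the integral being taken in `𝒱`. -/
def IsMildSolution (J : 𝒳 →L[ℂ] 𝒳) (X : ℝ → EnergySpace hB hP) : Prop :=
  Continuous X ∧ ∀ t : ℝ,
    ∃ h : EnergySpace.incl hB hP (X t - X 0) ∈ (hamiltonOp B J).inverse.domain,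
      (hamiltonOp B J).inverse ⟨_, h⟩ = EnergySpace.incl hB hP (∫ s in (0 : ℝ)..t, X s)

/-- `Z ∈ C(ℝ, 𝒳)` solves `i Ż = H Z` in the sense
`i H⁻¹ [Z(t) - Z(0)] = ∫₀ᵗ Z(s) ds` for all real `t`. -/
def IsMildSchrodingerSolution (H : 𝒳 →ₗ.[ℂ] 𝒳) (Z : ℝ → 𝒳) : Prop :=
  Continuous Z ∧ ∀ t : ℝ, ∃ h : Z t - Z 0 ∈ H.inverse.domain,
    Complex.I • H.inverse ⟨_, h⟩ = ∫ s in (0 : ℝ)..t, Z s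

/-- `X(t) = Λ⁻¹ e^{-iHt} Λ x`. -/
def kreinFlow (J : 𝒳 →L[ℂ] 𝒳) (t : ℝ) (x : EnergySpace hB hP) : EnergySpace hB hP :=
  (EnergySpace.lamIso hB hP).symm
    (expGroup (schrodingerOp hB hP J) t (EnergySpace.lamIso hB hP x))

end Sqrt

end KreinGroup

end

noncomputable section

/-! Everything is reduced to the bounded selfadjoint injective operator `K = Λ⁻¹ (iJ) Λ⁻¹`, which
inverts `H` because `J² = -1` makes `iJ` an involution; in the lemmas this is the graph hypothesis
`hH`. Inverses of such `K` are selfadjoint (`isSelfAdjoint_of_graph`).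

The group `e^{-it/K}` needs only the bounded functional calculus: `r e^{-it/r}` is continuous even
at `0`, so `K e^{-it/K}` is defined. It satisfies `‖K e^{-it/K} x‖ = ‖K x‖`, hence `K x ↦ K
e^{-it/K} x` extends isometrically from the dense range of `K`.

Uniqueness: the difference `W` of two solutions satisfies `(K W)' = -i W`, so symmetry of `K` makes
`‖K W‖²` constant (`IsMildSchrodingerSolution.unique`). Finally `A⁻¹ = Λ⁻¹ (i H⁻¹) Λ` on `𝒱`, so `Λ`
carries one equation to the other (`isMildSolution_iff`). -/

namespace KreinGroup

/-! ### Scalar estimates for `r e^{-it/r}`. -/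

/-- The function `r ↦ r e^{-it/r}`, extended by `0` to `r = 0`. -/
def invPhase (t r : ℝ) : ℂ := r * Complex.exp ((-(t / r) : ℝ) * Complex.I)

theorem norm_invPhase (t r : ℝ) : ‖invPhase t r‖ = |r| := by
  rw [invPhase, norm_mul, Complex.norm_exp_ofReal_mul_I, mul_one, Complex.norm_real,
    Real.norm_eq_abs]

@[fun_prop]
theorem continuous_invPhase (t : ℝ) : Continuous (invPhase t) := by
  rw [continuous_iff_continuousAt]
  intro r
  rcases eq_or_ne r 0 with rfl | hr
  · have h0 : invPhase t 0 = 0 := by simp [invPhase]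
    rw [ContinuousAt, h0]
    refine squeeze_zero_norm (fun r => (norm_invPhase t r).le) ?_
    simpa using (continuous_abs.tendsto (0 : ℝ))
  · unfold invPhase
    have h1 : ContinuousAt (fun r : ℝ => -(t / r)) r :=
      (continuousAt_const.div continuousAt_id hr).neg
    exact Complex.continuous_ofReal.continuousAt.mul
      (Complex.continuous_exp.continuousAt.comp
        ((Complex.continuous_ofReal.continuousAt.comp h1).mul continuousAt_const))

theorem invPhase_zero (r : ℝ) : invPhase 0 r = r := by simp [invPhase]

theorem invPhase_add (t s r : ℝ) :
    invPhase (t + s) r = invPhase t r * Complex.exp ((-(s / r) : ℝ) * Complex.I) := by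
  rw [invPhase, invPhase, mul_assoc, ← Complex.exp_add]
  congr 2
  push_cast
  ring

theorem invPhase_mul_invPhase (t s r : ℝ) :
    invPhase t r * invPhase s r = r * invPhase (t + s) r := by
  rw [invPhase_add, invPhase, invPhase]
  ring

/-- The factor `r` cancels the `1/r` in the phase difference, so the bound is uniform in `r` and
passes to operator norms. -/
theorem norm_invPhase_sub_le (t s r : ℝ) : ‖invPhase t r - invPhase s r‖ ≤ |t - s| := by
  obtain ⟨u, rfl⟩ : ∃ u, t = s + u := ⟨t - s, by ring⟩
  rcases eq_or_ne r 0 with rfl | hr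
  · simp [invPhase]
  have h : invPhase (s + u) r - invPhase s r =
      invPhase s r * (Complex.exp (Complex.I * (-(u / r) : ℝ)) - 1) := by
    rw [invPhase_add, mul_comm Complex.I]
    ring
  rw [h, norm_mul, norm_invPhase]
  calc |r| * ‖Complex.exp (Complex.I * (-(u / r) : ℝ)) - 1‖
      ≤ |r| * |-(u / r)| := by
        gcongr
        exact Real.norm_exp_I_mul_ofReal_sub_one_le
    _ = |s + u - s| := by
        rw [← abs_mul]
        rw [mul_neg, abs_neg, mul_div_cancel₀ _ hr, add_sub_cancel_left]

theorem norm_exp_ofReal_mul_I_sub_one_sub_le (θ : ℝ) :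
    ‖Complex.exp (θ * Complex.I) - 1 - θ * Complex.I‖ ≤ 2 * θ ^ 2 := by
  have hn : ‖(θ : ℂ) * Complex.I‖ = |θ| := by simp
  rcases le_total |θ| 1 with h | h
  · refine (Complex.norm_exp_sub_one_sub_id_le (hn.trans_le h)).trans ?_
    rw [hn, sq_abs]
    nlinarith [sq_nonneg θ]
  -- For `|θ| ≥ 1` no Taylor estimate is needed: the triangle inequality gives `2|θ| ≤ 2θ²`.
  · have h1 : ‖Complex.exp (θ * Complex.I) - 1‖ ≤ |θ| := by
      rw [mul_comm]
      exact Real.norm_exp_I_mul_ofReal_sub_one_le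
    refine (norm_sub_le _ _).trans ?_
    rw [hn, ← sq_abs θ]
    nlinarith

/-- The second factor `r` absorbs the `1/r²` of the Taylor remainder; this uniformity yields a
derivative in operator norm. -/
theorem norm_mul_invPhase_sub_le (t u r : ℝ) :
    ‖r * invPhase (t + u) r - r * invPhase t r - u * (-Complex.I * invPhase t r)‖
      ≤ 2 * u ^ 2 := by
  rcases eq_or_ne r 0 with rfl | hr
  · simp only [invPhase, Complex.ofReal_zero, zero_mul, mul_zero, sub_zero, norm_zero]
    positivity
  have hr' : (r : ℂ) ≠ 0 := by exact_mod_cast hr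
  have h : r * invPhase (t + u) r - r * invPhase t r - u * (-Complex.I * invPhase t r) =
      r * invPhase t r * (Complex.exp ((-(u / r) : ℝ) * Complex.I) - 1
        - (-(u / r) : ℝ) * Complex.I) := by
    rw [invPhase_add]
    push_cast
    field_simp
  rw [h, norm_mul, norm_mul, norm_invPhase, Complex.norm_real, Real.norm_eq_abs]
  calc |r| * |r| * ‖Complex.exp ((-(u / r) : ℝ) * Complex.I) - 1 - (-(u / r) : ℝ) * Complex.I‖
      ≤ |r| * |r| * (2 * (-(u / r)) ^ 2) := by
        gcongr
        exact norm_exp_ofReal_mul_I_sub_one_sub_le _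
    _ = 2 * u ^ 2 := by
        rw [abs_mul_abs_self]
        field_simp

/-! ### The operators `K e^{-it/K}` by functional calculus. -/

section CFC

variable {𝒳 : Type*} [NormedAddCommGroup 𝒳] [InnerProductSpace ℂ 𝒳] [CompleteSpace 𝒳]

/-- `K e^{-it/K}` for a bounded selfadjoint operator `K`. -/
def invPhaseOp (K : 𝒳 →L[ℂ] 𝒳) (t : ℝ) : 𝒳 →L[ℂ] 𝒳 := cfc (fun z : ℂ => invPhase t z.re) K

variable {K : 𝒳 →L[ℂ] 𝒳}

/-- The spectrum is real, so composing with `re` is harmless; it lets functions of a real variable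
enter the complex calculus. -/
theorem cfc_re_eq_self (hK : IsSelfAdjoint K) : cfc (fun z : ℂ => (z.re : ℂ)) K = K := by
  have : IsStarNormal K := hK.isStarNormal
  conv_rhs => rw [← cfc_id ℂ K]
  refine cfc_congr fun z hz => ?_
  exact (hK.mem_spectrum_eq_re hz).symm

theorem invPhaseOp_zero (hK : IsSelfAdjoint K) : invPhaseOp K 0 = K := by
  conv_rhs => rw [← cfc_re_eq_self hK]
  simp only [invPhaseOp, invPhase_zero]

theorem invPhaseOp_mul (hK : IsSelfAdjoint K) (t s : ℝ) :
    invPhaseOp K t * invPhaseOp K s = K * invPhaseOp K (t + s) := by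
  have : IsStarNormal K := hK.isStarNormal
  conv_rhs => enter [1]; rw [← cfc_re_eq_self hK]
  rw [invPhaseOp, invPhaseOp, invPhaseOp,
    ← cfc_mul _ _ K (by fun_prop) (by fun_prop),
    ← cfc_mul _ _ K (by fun_prop) (by fun_prop)]
  simp only [invPhase_mul_invPhase]

theorem star_invPhaseOp_mul_self (hK : IsSelfAdjoint K) (t : ℝ) :
    star (invPhaseOp K t) * invPhaseOp K t = star K * K := by
  have : IsStarNormal K := hK.isStarNormal
  have h (t : ℝ) : star (invPhaseOp K t) * invPhaseOp K t =
      cfc (fun z : ℂ => ((|z.re| ^ 2 : ℝ) : ℂ)) K := by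
    rw [invPhaseOp, ← cfc_star, ← cfc_mul _ _ K (by fun_prop) (by fun_prop)]
    congr 1
    ext z
    rw [← norm_invPhase t, Complex.star_def, Complex.conj_mul']
    push_cast
    rfl
  -- The modulus does not depend on `t`, so the value at `t = 0`, where the operator is `K`,
  -- decides.
  rw [h t, ← h 0, invPhaseOp_zero hK]

theorem norm_invPhaseOp_apply (hK : IsSelfAdjoint K) (t : ℝ) (x : 𝒳) :
    ‖invPhaseOp K t x‖ = ‖K x‖ := by
  rw [← sq_eq_sq₀ (norm_nonneg _) (norm_nonneg _),
    ContinuousLinearMap.apply_norm_sq_eq_inner_adjoint_left,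
    ContinuousLinearMap.apply_norm_sq_eq_inner_adjoint_left]
  have h := star_invPhaseOp_mul_self hK t
  rw [ContinuousLinearMap.star_eq_adjoint, ContinuousLinearMap.star_eq_adjoint] at h
  simp only [← ContinuousLinearMap.mul_def]
  rw [h]

theorem norm_invPhaseOp_sub_le (t s : ℝ) : ‖invPhaseOp K t - invPhaseOp K s‖ ≤ |t - s| := by
  rw [invPhaseOp, invPhaseOp, ← cfc_sub _ _ K (by fun_prop)
    (by fun_prop)]
  exact norm_cfc_le (abs_nonneg _) fun z _ => norm_invPhase_sub_le t s z.re

theorem continuous_invPhaseOp : Continuous (invPhaseOp K) := by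
  refine (LipschitzWith.of_dist_le_mul (K := 1) fun t s => ?_).continuous
  rw [dist_eq_norm, NNReal.coe_one, one_mul, Real.dist_eq]
  exact norm_invPhaseOp_sub_le t s

theorem hasDerivAt_mul_invPhaseOp (hK : IsSelfAdjoint K) (t : ℝ) :
    HasDerivAt (fun t => K * invPhaseOp K t) (-Complex.I • invPhaseOp K t) t := by
  have : IsStarNormal K := hK.isStarNormal
  have hKt (t : ℝ) : K * invPhaseOp K t = cfc (fun z : ℂ => z.re * invPhase t z.re) K := by
    conv_lhs => enter [1]; rw [← cfc_re_eq_self hK]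
    rw [invPhaseOp, ← cfc_mul _ _ K (by fun_prop) (by fun_prop)]
  rw [hasDerivAt_iff_isLittleO_nhds_zero]
  refine (Asymptotics.IsBigO.of_bound 2 (.of_forall fun u => ?_)).trans_isLittleO
    (Asymptotics.isLittleO_pow_id one_lt_two)
  have h : u • (-Complex.I • invPhaseOp K t) =
      cfc (fun z : ℂ => u * (-Complex.I * invPhase t z.re)) K := by
    rw [cfc_const_mul _ (fun z : ℂ => -Complex.I * invPhase t z.re) K (by fun_prop),
      cfc_const_mul _ _ K (by fun_prop), Complex.coe_smul, invPhaseOp]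
  rw [hKt, hKt, h, ← cfc_sub _ _ K (by fun_prop) (by fun_prop),
    ← cfc_sub (fun z : ℂ => z.re * invPhase (t + u) z.re - z.re * invPhase t z.re)
      (fun z : ℂ => u * (-Complex.I * invPhase t z.re)) K (by fun_prop) (by fun_prop)]
  refine norm_cfc_le (by positivity) fun z _ => ?_
  rw [norm_pow, Real.norm_eq_abs, sq_abs]
  exact norm_mul_invPhase_sub_le t u z.re

end CFC

/-! ### Inverses of bounded operators, their unitary groups and mild solutions. -/

section InverseOperator

variable {𝒳 : Type*} [NormedAddCommGroup 𝒳] [InnerProductSpace ℂ 𝒳] {K : 𝒳 →L[ℂ] 𝒳}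
  {H : 𝒳 →ₗ.[ℂ] 𝒳}

theorem exists_mem_domain_of_graph (hH : ∀ x y, (x, y) ∈ H.graph ↔ K y = x) (y : 𝒳) :
    ∃ h : K y ∈ H.domain, H ⟨K y, h⟩ = y := by
  obtain ⟨u, hu, hu'⟩ := (LinearPMap.mem_graph_iff _).mp ((hH _ _).mpr (rfl : K y = K y))
  have h : K y ∈ H.domain := by
    have := u.2
    rwa [hu] at this
  refine ⟨h, ?_⟩
  have e : (⟨K y, h⟩ : H.domain) = u := Subtype.ext hu.symm
  rw [e]
  exact hu'

theorem exists_mem_inverse_domain (hH : ∀ x y, (x, y) ∈ H.graph ↔ K y = x) (y : 𝒳) :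
    ∃ h : y ∈ H.inverse.domain, H.inverse ⟨y, h⟩ = K y := by
  have hker : LinearMap.ker H.toFun = ⊥ := by
    rw [LinearMap.ker_eq_bot']
    intro m hm
    have h1 := (hH _ _).mp (H.mem_graph m)
    have h2 : H m = 0 := hm
    rw [h2, map_zero] at h1
    exact Subtype.ext h1.symm
  have h1 : (y, K y) ∈ H.inverse.graph := by
    rw [LinearPMap.inverse_graph hker, Submodule.mem_map]
    exact ⟨(K y, y), (hH _ _).mpr rfl, rfl⟩
  obtain ⟨u, hu, hu'⟩ := (LinearPMap.mem_graph_iff _).mp h1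
  have h : y ∈ H.inverse.domain := by
    have := u.2
    rwa [hu] at this
  refine ⟨h, ?_⟩
  have e : (⟨y, h⟩ : H.inverse.domain) = u := Subtype.ext hu.symm
  rw [e]
  exact hu'

/-- Injectivity of `K` is single-valuedness of `H`. -/
theorem eq_zero_of_graph (hH : ∀ x y, (x, y) ∈ H.graph ↔ K y = x) {y : 𝒳} (hy : K y = 0) :
    y = 0 :=
  H.mem_graph_snd_inj ((hH _ _).mpr hy) H.graph.zero_mem rfl

theorem isMildSchrodingerSolution_iff (hH : ∀ x y, (x, y) ∈ H.graph ↔ K y = x) (Z : ℝ → 𝒳) :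
    IsMildSchrodingerSolution H Z ↔
      Continuous Z ∧ ∀ t, Complex.I • K (Z t - Z 0) = ∫ s in (0 : ℝ)..t, Z s := by
  refine and_congr_right fun _ => forall_congr' fun t => ?_
  obtain ⟨h, h'⟩ := exists_mem_inverse_domain hH (Z t - Z 0)
  rw [← h']
  exact ⟨fun ⟨_, h⟩ => h, fun h'' => ⟨h, h''⟩⟩

variable [CompleteSpace 𝒳]

theorem denseRange_of_isSelfAdjoint (hK : IsSelfAdjoint K) (h0 : ∀ y, K y = 0 → y = 0) :
    DenseRange K := by
  have h : (LinearMap.range (K : 𝒳 →ₗ[ℂ] 𝒳)).topologicalClosure = ⊤ := by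
    rw [Submodule.topologicalClosure_eq_top_iff, ContinuousLinearMap.orthogonal_range,
      ← ContinuousLinearMap.star_eq_adjoint, hK.star_eq, LinearMap.ker_eq_bot']
    exact h0
  have h' := (Submodule.dense_iff_topologicalClosure_eq_top).mpr h
  exact h'

theorem isSelfAdjoint_of_graph (hK : IsSelfAdjoint K)
    (hH : ∀ x y, (x, y) ∈ H.graph ↔ K y = x) : IsSelfAdjoint H := by
  have hsym : ∀ x y, ⟪K x, y⟫_ℂ = ⟪x, K y⟫_ℂ := fun x y => hK.isSymmetric x y
  have happ : ∀ x : H.domain, K (H x) = x := fun x => (hH _ _).mp (H.mem_graph x)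
  have hdense : Dense (H.domain : Set 𝒳) := by
    refine (denseRange_of_isSelfAdjoint hK fun y => eq_zero_of_graph hH).mono ?_
    rintro _ ⟨y, rfl⟩
    exact (exists_mem_domain_of_graph hH y).1
  rw [LinearPMap.isSelfAdjoint_def]
  apply le_antisymm
  -- Testing the adjoint relation against `K v`, where `H K v = v`, gives `⟪H* y, K v⟫ = ⟪y, v⟫`;
  -- moving `K` across puts `(y, H* y)` in the graph of `H`.
  · have key : ∀ y : H.adjoint.domain, K (H.adjoint y) = y := by
      intro y
      refine ext_inner_right ℂ fun v => ?_
      obtain ⟨h, h'⟩ := exists_mem_domain_of_graph hH v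
      have := LinearPMap.adjoint_isFormalAdjoint hdense y ⟨K v, h⟩
      rw [h'] at this
      rw [hsym]
      exact this
    rw [← LinearPMap.le_graph_iff]
    rintro ⟨x, y⟩ hxy
    obtain ⟨u, rfl, rfl⟩ := (LinearPMap.mem_graph_iff _).mp hxy
    exact (hH _ _).mpr (key u)
  · refine LinearPMap.IsFormalAdjoint.le_adjoint hdense fun x y => ?_
    conv_lhs => rw [← happ y]
    conv_rhs => rw [← happ x]
    exact (hsym _ _).symm

/-- The unitary group `e^{-it/K}` for an injective bounded selfadjoint operator `K`. -/
def invGroup (K : 𝒳 →L[ℂ] 𝒳) (t : ℝ) : 𝒳 →L[ℂ] 𝒳 :=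
  (invPhaseOp K t : 𝒳 →ₗ[ℂ] 𝒳).extendOfNorm (K : 𝒳 →ₗ[ℂ] 𝒳)

section

variable (hK : IsSelfAdjoint K) (h0 : ∀ y, K y = 0 → y = 0)
include hK h0

theorem invGroup_apply_apply (t : ℝ) (x : 𝒳) : invGroup K t (K x) = invPhaseOp K t x :=
  LinearMap.extendOfNorm_eq (denseRange_of_isSelfAdjoint hK h0)
    ⟨1, fun x => by simpa using (norm_invPhaseOp_apply hK t x).le⟩ x

theorem norm_invGroup_apply (t : ℝ) (z : 𝒳) : ‖invGroup K t z‖ = ‖z‖ := by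
  refine (denseRange_of_isSelfAdjoint hK h0).induction_on z
    (isClosed_eq (by fun_prop) (by fun_prop)) fun x => ?_
  rw [invGroup_apply_apply hK h0, norm_invPhaseOp_apply hK]

theorem invGroup_zero : invGroup K 0 = 1 := by
  ext z
  refine (denseRange_of_isSelfAdjoint hK h0).induction_on z
    (isClosed_eq (by fun_prop) (by fun_prop)) fun x => ?_
  rw [invGroup_apply_apply hK h0, invPhaseOp_zero hK]
  rfl

theorem apply_invGroup (t : ℝ) (z : 𝒳) : K (invGroup K t z) = invGroup K t (K z) := by
  refine (denseRange_of_isSelfAdjoint hK h0).induction_on z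
    (isClosed_eq (by fun_prop) (by fun_prop)) fun x => ?_
  have h := invPhaseOp_mul hK t 0
  rw [invPhaseOp_zero hK, add_zero] at h
  rw [invGroup_apply_apply hK h0, invGroup_apply_apply hK h0]
  exact (DFunLike.congr_fun h x).symm

theorem invGroup_add (s t : ℝ) : invGroup K (s + t) = invGroup K s * invGroup K t := by
  ext z
  refine (denseRange_of_isSelfAdjoint hK h0).induction_on z
    (isClosed_eq (by fun_prop) (by fun_prop)) fun x => ?_
  rw [invGroup_apply_apply hK h0, ← sub_eq_zero]
  -- `K` is applied to both sides because the product law for `invPhaseOp` carries an extra factor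
  -- `K`; injectivity removes it.
  apply h0
  rw [map_sub, sub_eq_zero, mul_apply_eq_comp, invGroup_apply_apply hK h0,
    apply_invGroup hK h0, invGroup_apply_apply hK h0]
  exact (DFunLike.congr_fun (invPhaseOp_mul hK s t) x).symm

theorem invGroup_mem_unitary (t : ℝ) : invGroup K t ∈ unitary (𝒳 →L[ℂ] 𝒳) := by
  have h1 : star (invGroup K t) * invGroup K t = 1 :=
    (ContinuousLinearMap.norm_map_iff_adjoint_comp_self _).mp (norm_invGroup_apply hK h0 t)
  have h2 : invGroup K t * invGroup K (-t) = 1 := by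
    rw [← invGroup_add hK h0, add_neg_cancel, invGroup_zero hK h0]
  refine Unitary.mem_iff.mpr ⟨h1, ?_⟩
  rw [left_inv_eq_right_inv h1 h2, h2]

/-- Orbits of points `K x` are norm continuous, and by isometry they approximate the orbit of `z`
uniformly in `t`. -/
theorem continuous_invGroup_apply (z : 𝒳) : Continuous fun t => invGroup K t z := by
  refine continuous_of_uniform_approx_of_continuous fun u hu => ?_
  obtain ⟨ε, hε, hεu⟩ := Metric.mem_uniformity_dist.mp hu
  obtain ⟨x, hx⟩ := (denseRange_of_isSelfAdjoint hK h0).exists_dist_lt z hε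
  refine ⟨fun t => invGroup K t (K x), ?_, fun t => hεu ?_⟩
  · simp only [invGroup_apply_apply hK h0]
    exact continuous_invPhaseOp.clm_apply continuous_const
  · rwa [dist_eq_norm, ← map_sub, norm_invGroup_apply hK h0, ← dist_eq_norm]

/-- On the range of `K` this is the fundamental theorem of calculus; both sides are continuous in
`z`, the integral being `|t|`-Lipschitz. -/
theorem integral_invGroup_apply (t : ℝ) (z : 𝒳) :
    ∫ s in (0 : ℝ)..t, invGroup K s z = Complex.I • (K (invGroup K t z) - K z) := by
  have hint (z : 𝒳) : IntervalIntegrable (fun s => invGroup K s z) MeasureTheory.volume 0 t :=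
    (continuous_invGroup_apply hK h0 z).intervalIntegrable _ _
  have hcont : Continuous fun z => ∫ s in (0 : ℝ)..t, invGroup K s z := by
    refine (LipschitzWith.of_dist_le_mul (K := ‖t‖₊) fun z w => ?_).continuous
    rw [dist_eq_norm, ← intervalIntegral.integral_sub (hint z) (hint w), coe_nnnorm, mul_comm]
    refine (intervalIntegral.norm_integral_le_of_norm_le_const fun s _ => ?_).trans
      (by rw [sub_zero, Real.norm_eq_abs])
    rw [← map_sub, norm_invGroup_apply hK h0, dist_eq_norm]
  refine (denseRange_of_isSelfAdjoint hK h0).induction_on z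
    (isClosed_eq hcont (by fun_prop)) fun x => ?_
  have hd (s : ℝ) : HasDerivAt (fun s => Complex.I • K (invGroup K s (K x)))
      (invGroup K s (K x)) s := by
    have h := ((ContinuousLinearMap.apply ℂ 𝒳 x).hasFDerivAt.restrictScalars ℝ |>.comp_hasDerivAt s
      (hasDerivAt_mul_invPhaseOp hK s)).fun_const_smul Complex.I
    simp only [Function.comp_def, ContinuousLinearMap.coe_restrictScalars',
      ContinuousLinearMap.apply_apply, mul_apply_eq_comp, smul_apply, smul_smul, mul_neg, Complex.I_mul_I, neg_neg,
      one_smul] at h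
    simpa only [invGroup_apply_apply hK h0] using h
  rw [intervalIntegral.integral_eq_sub_of_hasDerivAt (fun s _ => hd s) (hint _), ← smul_sub,
    invGroup_zero hK h0]
  rfl

theorem hasDerivAt_apply_invGroup (t : ℝ) (z : 𝒳) :
    HasDerivAt (fun s => K (invGroup K s z)) (-(Complex.I • invGroup K t z)) t := by
  have h := (((continuous_invGroup_apply hK h0 z).integral_hasStrictDerivAt 0 t).hasDerivAt
    |>.fun_const_smul (-Complex.I)).add_const (K z)
  simp only [integral_invGroup_apply hK h0, smul_smul, neg_mul, Complex.I_mul_I, neg_neg,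
    one_smul, sub_add_cancel, neg_smul] at h
  exact h

theorem isUnitaryGroupOf_invGroup (hH : ∀ x y, (x, y) ∈ H.graph ↔ K y = x) :
    IsUnitaryGroupOf H (invGroup K) where
  unitary := invGroup_mem_unitary hK h0
  zero := invGroup_zero hK h0
  add := invGroup_add hK h0
  continuous := continuous_invGroup_apply hK h0
  generator z w := by
    rw [hH]
    constructor
    · rintro rfl
      have h := hasDerivAt_apply_invGroup hK h0 0 w
      simpa only [apply_invGroup hK h0, invGroup_zero hK h0, one_apply_eq_self] using h
    · intro h
      -- Applying `K` to the orbit gives a second value for the derivative at `0`; comparing the two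
      -- yields `K w = z`.
      have h1 := K.hasFDerivAt.restrictScalars ℝ |>.comp_hasDerivAt (0 : ℝ) h
      have h2 := h1.unique (hasDerivAt_apply_invGroup hK h0 0 z)
      simpa [invGroup_zero hK h0] using h2

end

/-- `expGroup` is a choice not known to equal `invGroup`, so what follows uses only the defining
properties of a group generated by `-iH`. -/
theorem IsUnitaryGroupOf.expGroup {U : ℝ → 𝒳 →L[ℂ] 𝒳} (hU : IsUnitaryGroupOf H U) :
    IsUnitaryGroupOf H (expGroup H) := by
  have h : ∃ U, IsUnitaryGroupOf H U := ⟨U, hU⟩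
  rw [KreinGroup.expGroup, dif_pos h]
  exact h.choose_spec

theorem IsUnitaryGroupOf.isMildSchrodingerSolution {U : ℝ → 𝒳 →L[ℂ] 𝒳}
    (hU : IsUnitaryGroupOf H U) (hH : ∀ x y, (x, y) ∈ H.graph ↔ K y = x) (z : 𝒳) :
    IsMildSchrodingerSolution H fun t => U t z := by
  have hd (t : ℝ) (w : 𝒳) :
      HasDerivAt (fun s => U (t + s) (K w)) (U t (-(Complex.I • w))) 0 := by
    simp only [hU.add]
    exact (U t).hasFDerivAt.restrictScalars ℝ |>.comp_hasDerivAt (0 : ℝ)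
      ((hU.generator _ _).mp ((hH _ _).mpr rfl))
  -- The orbit of `U t (K w)` has derivative `-i U t w` at `0`, so the generator property places `(U
  -- t (K w), U t w)` in the graph of `H`.
  have hcomm (t : ℝ) (w : 𝒳) : K (U t w) = U t (K w) := by
    refine (hH _ _).mp ((hU.generator _ _).mpr ?_)
    have h := hd t w
    simp only [add_comm t, hU.add] at h
    simpa using h
  refine (isMildSchrodingerSolution_iff hH _).mpr ⟨hU.continuous z, fun t => ?_⟩
  have hd' (t : ℝ) : HasDerivAt (fun s => Complex.I • K (U s z)) (U t z) t := by
    have h := (hd t z).fun_const_smul Complex.I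
    rw [← sub_self t] at h
    have h' := h.comp_sub_const t t
    simp only [map_neg, map_smul, smul_neg, smul_smul, Complex.I_mul_I, neg_smul, one_smul,
      neg_neg, add_sub_cancel] at h'
    simpa only [hcomm] using h'
  rw [intervalIntegral.integral_eq_sub_of_hasDerivAt (fun s _ => hd' s)
    ((hU.continuous z).intervalIntegrable _ _), map_sub, smul_sub]

theorem IsMildSchrodingerSolution.unique (hK : IsSelfAdjoint K)
    (hH : ∀ x y, (x, y) ∈ H.graph ↔ K y = x) {Z Z' : ℝ → 𝒳}
    (hZ : IsMildSchrodingerSolution H Z) (hZ' : IsMildSchrodingerSolution H Z')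
    (h : Z 0 = Z' 0) : Z = Z' := by
  rw [isMildSchrodingerSolution_iff hH] at hZ hZ'
  obtain ⟨hc, hi⟩ := hZ
  obtain ⟨hc', hi'⟩ := hZ'
  let W : ℝ → 𝒳 := fun t => Z t - Z' t
  have hW : Continuous W := hc.sub hc'
  have hWi (t : ℝ) : K (W t) = -Complex.I • ∫ s in (0 : ℝ)..t, W s := by
    rw [intervalIntegral.integral_sub (hc.intervalIntegrable _ _) (hc'.intervalIntegrable _ _),
      ← hi, ← hi', ← smul_sub, ← map_sub, h, sub_sub_sub_cancel_right, smul_smul, neg_mul,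
      Complex.I_mul_I, neg_neg, one_smul]
  -- Only `K W` is differentiated: `W` is merely continuous.
  have hd (t : ℝ) : HasDerivAt (fun s => K (W s)) (-Complex.I • W t) t := by
    simp only [hWi]
    exact (hW.integral_hasStrictDerivAt 0 t).hasDerivAt.const_smul _
  have hd2 (t : ℝ) : HasDerivAt (fun s => ⟪K (W s), K (W s)⟫_ℂ) 0 t := by
    have h1 := (hd t).inner ℂ (hd t)
    have h2 : ⟪K (W t), -Complex.I • W t⟫_ℂ + ⟪-Complex.I • W t, K (W t)⟫_ℂ = 0 := by
      have h3 : ⟪K (W t), W t⟫_ℂ = ⟪W t, K (W t)⟫_ℂ := hK.isSymmetric _ _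
      rw [inner_smul_left, inner_smul_right, h3]
      simp
    rwa [h2] at h1
  ext t
  have h1 := is_const_of_deriv_eq_zero (fun t => (hd2 t).differentiableAt)
    (fun t => (hd2 t).deriv) t 0
  have h2 : W 0 = 0 := sub_eq_zero.mpr h
  rw [h2, map_zero, inner_zero_left, inner_self_eq_zero] at h1
  exact sub_eq_zero.mp (eq_zero_of_graph hH h1)

end InverseOperator

theorem mem_compPMap_graph {𝒳 : Type*} [NormedAddCommGroup 𝒳] [InnerProductSpace ℂ 𝒳]
    {T : 𝒳 →L[ℂ] 𝒳} {f : 𝒳 →ₗ.[ℂ] 𝒳} {x y : 𝒳} :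
    (x, y) ∈ ((T : 𝒳 →ₗ[ℂ] 𝒳).compPMap f).graph ↔ ∃ w, (x, w) ∈ f.graph ∧ T w = y := by
  simp only [LinearPMap.mem_graph_iff]
  constructor
  · rintro ⟨u, hu, hu'⟩
    exact ⟨f u, ⟨u, hu, rfl⟩, hu'⟩
  · rintro ⟨_, ⟨u, hu, rfl⟩, rfl⟩
    exact ⟨u, hu, rfl⟩

/-! ### The bounded inverses of `Λ`, `H` and `A`, and the passage to `𝒱`. -/

section Energy

variable {𝒳 : Type*} [NormedAddCommGroup 𝒳] [InnerProductSpace ℂ 𝒳] [CompleteSpace 𝒳]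
  {B : 𝒳 →ₗ.[ℂ] 𝒳} (hB : IsSelfAdjoint B) (hP : ConditionP B)

/-- Symmetry of `Λ` passes to its everywhere defined inverse, which is then bounded by
Hellinger–Toeplitz and selfadjoint. -/
theorem incl_lamIso_symm_isSymmetric :
    (EnergySpace.incl hB hP ∘ₗ
      (EnergySpace.lamIso hB hP).symm.toLinearEquiv.toLinearMap).IsSymmetric := by
  have hsa := (opSqrt_spec hB hP).isSelfAdjoint
  have hfa := LinearPMap.adjoint_isFormalAdjoint hsa.dense_domain
  rw [LinearPMap.isSelfAdjoint_def.mp hsa] at hfa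
  intro x y
  obtain ⟨u, rfl⟩ := (EnergySpace.lamIso hB hP).surjective x
  obtain ⟨v, rfl⟩ := (EnergySpace.lamIso hB hP).surjective y
  simp only [LinearMap.comp_apply, LinearEquiv.coe_coe, LinearIsometryEquiv.coe_toLinearEquiv,
    LinearIsometryEquiv.symm_apply_apply]
  exact (hfa u v).symm

/-- `Λ⁻¹` as a bounded operator on `𝒳`. -/
def sqrtInv : 𝒳 →L[ℂ] 𝒳 where
  toLinearMap := EnergySpace.incl hB hP ∘ₗ
    (EnergySpace.lamIso hB hP).symm.toLinearEquiv.toLinearMap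
  cont := (incl_lamIso_symm_isSymmetric hB hP).continuous

theorem sqrtInv_lamIso (x : EnergySpace hB hP) :
    sqrtInv hB hP (EnergySpace.lamIso hB hP x) = EnergySpace.incl hB hP x :=
  congrArg (EnergySpace.incl hB hP) ((EnergySpace.lamIso hB hP).symm_apply_apply x)

theorem isSelfAdjoint_sqrtInv : IsSelfAdjoint (sqrtInv hB hP) :=
  ContinuousLinearMap.isSelfAdjoint_iff_isSymmetric.mpr (incl_lamIso_symm_isSymmetric hB hP)

theorem mem_opSqrt_graph (x y : 𝒳) :
    (x, y) ∈ (opSqrt hB hP).graph ↔ sqrtInv hB hP y = x := by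
  rw [LinearPMap.mem_graph_iff]
  constructor
  · rintro ⟨u, rfl, rfl⟩
    exact sqrtInv_lamIso hB hP u
  · rintro rfl
    exact ⟨(EnergySpace.lamIso hB hP).symm y, rfl, (EnergySpace.lamIso hB hP).apply_symm_apply y⟩

theorem mem_graph_iff_sqrtInv (x y : 𝒳) :
    (x, y) ∈ B.graph ↔ sqrtInv hB hP (sqrtInv hB hP y) = x := by
  have h : B.graph = (pcomp (opSqrt hB hP) (opSqrt hB hP)).graph :=
    congrArg LinearPMap.graph (opSqrt_spec hB hP).sq.symm
  rw [h, mem_pcomp_graph]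
  simp only [mem_opSqrt_graph]
  exact ⟨fun ⟨z, h, h'⟩ => h' ▸ h, fun h => ⟨_, h, rfl⟩⟩

variable {J : 𝒳 →L[ℂ] 𝒳}

/-- `H⁻¹ = Λ⁻¹ (iJ) Λ⁻¹`. -/
def schrodingerInv (J : 𝒳 →L[ℂ] 𝒳) : 𝒳 →L[ℂ] 𝒳 :=
  sqrtInv hB hP * (Complex.I • J) * sqrtInv hB hP

theorem isSelfAdjoint_schrodingerInv (hJ : ContinuousLinearMap.adjoint J = -J) :
    IsSelfAdjoint (schrodingerInv hB hP J) := by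
  have h : IsSelfAdjoint (Complex.I • J) := by
    rw [← ContinuousLinearMap.star_eq_adjoint] at hJ
    rw [IsSelfAdjoint, star_smul, hJ, Complex.star_def, Complex.conj_I, neg_smul_neg]
  have h' := h.conjugate (sqrtInv hB hP)
  rwa [(isSelfAdjoint_sqrtInv hB hP).star_eq] at h'

theorem mem_schrodingerOp_graph (hJ2 : J ∘L J = -1) (x y : 𝒳) :
    (x, y) ∈ (schrodingerOp hB hP J).graph ↔ schrodingerInv hB hP J y = x := by
  have hJJ (v : 𝒳) : J (J v) = -v := DFunLike.congr_fun hJ2 v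
  have hI (v : 𝒳) : (Complex.I • J) ((Complex.I • J) v) = v := by
    simp [hJJ, smul_smul]
  rw [schrodingerOp, mem_pcomp_graph]
  simp only [mem_compPMap_graph, mem_opSqrt_graph, schrodingerInv, mul_apply_eq_comp]
  constructor
  · rintro ⟨_, ⟨w, rfl, rfl⟩, h⟩
    rw [h, hI]
  · rintro rfl
    exact ⟨_, ⟨_, rfl, hI _⟩, rfl⟩

/-- Since `J⁻¹ = -J`, the inverse of `A = JB` is `-Λ⁻² J`. -/
theorem mem_hamiltonOp_graph (hJ2 : J ∘L J = -1) (x y : 𝒳) :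
    (x, y) ∈ (hamiltonOp B J).graph ↔ (-(sqrtInv hB hP * sqrtInv hB hP * J)) y = x := by
  have hJJ (v : 𝒳) : J (J v) = -v := DFunLike.congr_fun hJ2 v
  rw [hamiltonOp, mem_compPMap_graph]
  simp only [mem_graph_iff_sqrtInv hB hP, neg_apply, mul_apply_eq_comp]
  constructor
  · rintro ⟨w, rfl, rfl⟩
    simp [hJJ]
  · rintro rfl
    exact ⟨-J y, by simp, by simp [hJJ]⟩

theorem incl_injective : Function.Injective (EnergySpace.incl hB hP) :=
  Subtype.val_injective

theorem isMildSolution_iff (hJ2 : J ∘L J = -1) (X : ℝ → EnergySpace hB hP) :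
    IsMildSolution hB hP J X ↔
      IsMildSchrodingerSolution (schrodingerOp hB hP J)
        (fun t => EnergySpace.lamIso hB hP (X t)) := by
  rw [isMildSchrodingerSolution_iff (mem_schrodingerOp_graph hB hP hJ2), IsMildSolution]
  refine and_congr (EnergySpace.lamIso hB hP).comp_continuous_iff.symm
    (forall_congr' fun t => ?_)
  obtain ⟨h, h'⟩ := exists_mem_inverse_domain (mem_hamiltonOp_graph hB hP hJ2)
    (EnergySpace.incl hB hP (X t - X 0))
  -- This is `A⁻¹ = Λ⁻¹ (i H⁻¹) Λ` on `𝒱`, the sign coming from `i · i = -1`; injectivity of `Λ⁻¹`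
  -- then cancels the outer factor.
  have h1 : (-(sqrtInv hB hP * sqrtInv hB hP * J)) (EnergySpace.incl hB hP (X t - X 0)) =
      sqrtInv hB hP (Complex.I • schrodingerInv hB hP J
        (EnergySpace.lamIso hB hP (X t) - EnergySpace.lamIso hB hP (X 0))) := by
    rw [← map_sub, ← sqrtInv_lamIso]
    simp [schrodingerInv, smul_smul]
  have h2 : ∫ s in (0 : ℝ)..t, EnergySpace.lamIso hB hP (X s) =
      EnergySpace.lamIso hB hP (∫ s in (0 : ℝ)..t, X s) :=
    (EnergySpace.lamIso hB hP).toLinearIsometry.intervalIntegral_comp_comm X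
  have hinj : Function.Injective (sqrtInv hB hP) :=
    (incl_injective hB hP).comp (EnergySpace.lamIso hB hP).symm.injective
  rw [h2, ← hinj.eq_iff, ← h1, sqrtInv_lamIso, ← h']
  exact ⟨fun ⟨_, h⟩ => h, fun h'' => ⟨h, h''⟩⟩

end Energy

end KreinGroup

end

theorem lemma2p3 {𝒳 : Type*} [NormedAddCommGroup 𝒳] [InnerProductSpace ℂ 𝒳] [CompleteSpace 𝒳]
    (B : 𝒳 →ₗ.[ℂ] 𝒳) (J : 𝒳 →L[ℂ] 𝒳) (hB : IsSelfAdjoint B)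
    (hJ : ContinuousLinearMap.adjoint J = -J) (hJ2 : J ∘L J = -1)
    (hP : KreinGroup.ConditionP B) :
    -- `H` is selfadjoint and has the group `e^{-iHt}`
    (IsSelfAdjoint (KreinGroup.schrodingerOp hB hP J) ∧
      KreinGroup.IsUnitaryGroupOf (KreinGroup.schrodingerOp hB hP J)
        (KreinGroup.expGroup (KreinGroup.schrodingerOp hB hP J))) ∧
    -- the Schrödinger equation
    (∀ z₀ : 𝒳,
      KreinGroup.IsMildSchrodingerSolution (KreinGroup.schrodingerOp hB hP J)
        (fun t => KreinGroup.expGroup (KreinGroup.schrodingerOp hB hP J) t z₀) ∧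
      ∀ Z : ℝ → 𝒳,
        KreinGroup.IsMildSchrodingerSolution (KreinGroup.schrodingerOp hB hP J) Z → Z 0 = z₀ →
          Z = fun t => KreinGroup.expGroup (KreinGroup.schrodingerOp hB hP J) t z₀) ∧
    -- existence and uniqueness for `Ẋ = A X`
    (∀ x₀ : KreinGroup.EnergySpace hB hP,
      KreinGroup.kreinFlow hB hP J 0 x₀ = x₀ ∧
      KreinGroup.IsMildSolution hB hP J (fun t => KreinGroup.kreinFlow hB hP J t x₀) ∧
      ∀ X : ℝ → KreinGroup.EnergySpace hB hP,
        KreinGroup.IsMildSolution hB hP J X → X 0 = x₀ →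
          X = fun t => KreinGroup.kreinFlow hB hP J t x₀) ∧
    -- the dynamical group is a group of unitary operators of `𝒱`
    (∃ V : ℝ → (KreinGroup.EnergySpace hB hP ≃ₗᵢ[ℂ] KreinGroup.EnergySpace hB hP),
      (∀ t x, V t x = KreinGroup.kreinFlow hB hP J t x) ∧
      V 0 = LinearIsometryEquiv.refl ℂ (KreinGroup.EnergySpace hB hP) ∧
      ∀ s t x, V (s + t) x = V s (V t x)) := by
  have hK := KreinGroup.isSelfAdjoint_schrodingerInv hB hP hJ
  have hH := KreinGroup.mem_schrodingerOp_graph hB hP hJ2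
  have hU := (KreinGroup.isUnitaryGroupOf_invGroup hK
    (fun _ => KreinGroup.eq_zero_of_graph hH) hH).expGroup
  have hsol (z₀ : 𝒳) := hU.isMildSchrodingerSolution hH z₀
  have huniq (z₀ : 𝒳) (Z : ℝ → 𝒳)
      (hZ : KreinGroup.IsMildSchrodingerSolution (KreinGroup.schrodingerOp hB hP J) Z)
      (h : Z 0 = z₀) :
      Z = fun t => KreinGroup.expGroup (KreinGroup.schrodingerOp hB hP J) t z₀ :=
    hZ.unique hK hH (hsol z₀) (by simp [h, hU.zero])
  have hflow0 (x : KreinGroup.EnergySpace hB hP) : KreinGroup.kreinFlow hB hP J 0 x = x := by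
    simp [KreinGroup.kreinFlow, hU.zero]
  refine ⟨⟨KreinGroup.isSelfAdjoint_of_graph hK hH, hU⟩, fun z₀ => ⟨hsol z₀, huniq z₀⟩,
    fun x₀ => ⟨hflow0 x₀, ?_, fun X hX h0 => ?_⟩, ?_⟩
  · rw [KreinGroup.isMildSolution_iff hB hP hJ2]
    simpa [KreinGroup.kreinFlow] using hsol (KreinGroup.EnergySpace.lamIso hB hP x₀)
  · rw [KreinGroup.isMildSolution_iff hB hP hJ2] at hX
    have h := huniq _ _ hX (congrArg (KreinGroup.EnergySpace.lamIso hB hP) h0)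
    ext t
    apply (KreinGroup.EnergySpace.lamIso hB hP).injective
    simpa [KreinGroup.kreinFlow] using congrFun h t
  · refine ⟨fun t => ((KreinGroup.EnergySpace.lamIso hB hP).trans
      (Unitary.linearIsometryEquiv ⟨_, hU.unitary t⟩)).trans
        (KreinGroup.EnergySpace.lamIso hB hP).symm, fun t x => rfl, ?_, fun s t x => ?_⟩
    · ext x
      exact hflow0 x
    · change KreinGroup.kreinFlow hB hP J (s + t) x =
        KreinGroup.kreinFlow hB hP J s (KreinGroup.kreinFlow hB hP J t x)
      simp [KreinGroup.kreinFlow, hU.add]
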